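/- Let $M$ be a finite matroid with lattice of flats $L(M)$, and for a flat $F$ let $M_F$ be the contraction of $M$ by $F$ (the matroid on $E\smallsetminus F$ whose flats are the sets $G\smallsetminus F$, $G\in L(M)$, $G\supseteq F$). The Kazhdan--Lusztig polynomials $P_M(t)\in\mathbb{Z}[t]$ of finite loopless matroids form the unique family such that $P_M(t)=1$ if $\operatorname{rk} M=0$, $\deg P_M(t)<(\operatorname{rk} M)/2$ if $\operatorname{rk} M>0$, and $Z_M(t):=\sum_{F\in L(M)}t^{\operatorname{rk} F}P_{M_F}(t)$ satisfies $Z_M(t)=t^{\operatorname{rk} M}Z_M(t^{-1})$ for every $M$. For a finite graph $G$, write $P_G(t)$ for the Kazhdan--Lusztig polynomial of the cycle matroid of $G$ (ground set the edges of $G$, independent sets the forests). For $n\ge 2$, let $T_n$ be the thagomizer graph, obtained from the complete bipartite graph $K_{2,n}$ by adding one edge joining the two vertices of the part of size $2$. Then $$P_{T_n}(t)=P_{K_{2,n}}(t)-t .$$ -/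

import Mathlib

open scoped Polynomial

/-! ### The cycle matroid of a graph -/

namespace SimpleGraph

variable {V : Type*}

/-- A set of edges of `G` is a forest if it contains no cycle. -/
def IsForestSet (G : SimpleGraph V) (I : Set (Sym2 V)) : Prop :=
  I ⊆ G.edgeSet ∧ (fromEdgeSet I).IsAcyclic

theorem edgeSet_fromEdgeSet_of_subset (G : SimpleGraph V) {I : Set (Sym2 V)}
    (h : I ⊆ G.edgeSet) : (fromEdgeSet I).edgeSet = I := by
  rw [edgeSet_fromEdgeSet, sdiff_eq_left, Set.disjoint_left]
  exact fun e he => G.not_isDiag_of_mem_edgeSet (h he)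

theorem maximal_isForestSet_iff (G : SimpleGraph V) {X I : Set (Sym2 V)} (hX : X ⊆ G.edgeSet) :
    Maximal (fun K => G.IsForestSet K ∧ K ⊆ X) I ↔
      I ⊆ X ∧ Maximal (fun H => H ≤ fromEdgeSet X ∧ H.IsAcyclic) (fromEdgeSet I) := by
  constructor
  · intro h
    refine ⟨h.prop.2, ⟨fromEdgeSet_mono h.prop.2, h.prop.1.2⟩, fun H hH hIH => ?_⟩
    have hHX : H.edgeSet ⊆ X := by
      have := edgeSet_mono hH.1
      rwa [edgeSet_fromEdgeSet_of_subset G hX] at this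
    have h1 : G.IsForestSet H.edgeSet ∧ H.edgeSet ⊆ X :=
      ⟨⟨hHX.trans hX, by rw [fromEdgeSet_edgeSet]; exact hH.2⟩, hHX⟩
    have h2 : I ⊆ H.edgeSet := by
      have := edgeSet_mono hIH
      rwa [edgeSet_fromEdgeSet_of_subset G h.prop.1.1] at this
    have h3 := fromEdgeSet_mono (h.le_of_ge h1 h2)
    rwa [fromEdgeSet_edgeSet] at h3
  · rintro ⟨hIX, h⟩
    refine ⟨⟨⟨hIX.trans hX, h.prop.2⟩, hIX⟩, fun K hK hIK => ?_⟩
    have h1 := edgeSet_mono (h.le_of_ge ⟨fromEdgeSet_mono hK.2, hK.1.2⟩ (fromEdgeSet_mono hIK))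
    rwa [edgeSet_fromEdgeSet_of_subset G hK.1.1,
      edgeSet_fromEdgeSet_of_subset G (hIX.trans hX)] at h1

theorem maximal_isForestSet_iff_reachable (G : SimpleGraph V) {I : Set (Sym2 V)}
    (hI : G.IsForestSet I) :
    Maximal G.IsForestSet I ↔ (fromEdgeSet I).Reachable = G.Reachable := by
  have h1 : Maximal G.IsForestSet I ↔
      Maximal (fun K => G.IsForestSet K ∧ K ⊆ G.edgeSet) I := by
    have : (fun K => G.IsForestSet K ∧ K ⊆ G.edgeSet) = G.IsForestSet := by
      funext K
      exact propext ⟨fun h => h.1, fun h => ⟨h, h.1⟩⟩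
    rw [this]
  rw [h1, maximal_isForestSet_iff G subset_rfl, fromEdgeSet_edgeSet,
    maximal_isAcyclic_iff_reachable_eq _ hI.2]
  · exact and_iff_right hI.1
  · have := fromEdgeSet_mono hI.1
    rwa [fromEdgeSet_edgeSet] at this

/-- The cycle matroid (graphic matroid) of a simple graph: the ground set is the set of edges and
the independent sets are the forests. -/
def cycleMatroid (G : SimpleGraph V) : Matroid (Sym2 V) :=
  IndepMatroid.matroid
    { E := G.edgeSet
      Indep := G.IsForestSet
      indep_empty := ⟨Set.empty_subset _, by rw [fromEdgeSet_empty]; exact isAcyclic_bot⟩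
      indep_subset := fun _ _ hJ hIJ => ⟨hIJ.trans hJ.1, hJ.2.anti (fromEdgeSet_mono hIJ)⟩
      indep_aug := by
        intro I B hI hImax hB
        by_contra hcon
        push Not at hcon
        apply hImax
        rw [maximal_isForestSet_iff_reachable G hI]
        have hBr := (maximal_isForestSet_iff_reachable G hB.prop).1 hB
        have hle : fromEdgeSet I ≤ G := by
          have := fromEdgeSet_mono hI.1
          rwa [fromEdgeSet_edgeSet] at this
        have hadj : ∀ u v, (fromEdgeSet B).Adj u v → (fromEdgeSet I).Reachable u v := by
          intro u v huv
          rw [fromEdgeSet_adj] at huv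
          by_cases hmem : s(u, v) ∈ I
          · exact Adj.reachable (by rw [fromEdgeSet_adj]; exact ⟨hmem, huv.2⟩)
          by_contra hnr
          refine hcon _ ⟨huv.1, hmem⟩ ⟨Set.insert_subset (hB.prop.1 huv.1) hI.1, ?_⟩
          have h1 := hI.2.sup_edge_of_not_reachable hnr
          have h2 : fromEdgeSet (insert s(u, v) I) = fromEdgeSet I ⊔ edge u v := by
            rw [edge, ← fromEdgeSet_union, Set.union_singleton]
          rwa [h2]
        ext u v
        refine ⟨fun h => h.mono hle, fun h => ?_⟩
        rw [← hBr] at h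
        obtain ⟨p⟩ := h
        induction p with
        | nil => exact Reachable.refl _
        | cons h p ih => exact (hadj _ _ h).trans ih
      indep_maximal := by
        intro X hX I hI hIX
        obtain ⟨H, hIH, hH⟩ := exists_maximal_isAcyclic_of_le_isAcyclic
          (G := fromEdgeSet X) (H := fromEdgeSet I) (fromEdgeSet_mono hIX) hI.2
        refine ⟨H.edgeSet, ?_, (maximal_isForestSet_iff G hX).2 ⟨?_, ?_⟩⟩
        · have := edgeSet_mono hIH
          rwa [edgeSet_fromEdgeSet_of_subset G hI.1] at this
        · have := edgeSet_mono hH.prop.1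
          rwa [edgeSet_fromEdgeSet_of_subset G hX] at this
        · rwa [fromEdgeSet_edgeSet]
      subset_ground := fun _ hI => hI.1 }

theorem cycleMatroid_indep_iff (G : SimpleGraph V) (I : Set (Sym2 V)) :
    G.cycleMatroid.Indep I ↔ I ⊆ G.edgeSet ∧ (fromEdgeSet I).IsAcyclic := Iff.rfl

theorem cycleMatroid_loopless (G : SimpleGraph V) : G.cycleMatroid.Loopless := by
  rw [Matroid.loopless_iff_forall_isNonloop]
  intro e he
  rw [← Matroid.indep_singleton, cycleMatroid_indep_iff]
  refine ⟨Set.singleton_subset_iff.2 he, ?_⟩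
  induction e with
  | _ u v =>
    have huv : u ≠ v := G.ne_of_adj he
    have h := (isAcyclic_bot (V := V)).sup_edge_of_not_reachable
      (u := u) (v := v) (by rwa [reachable_bot])
    rwa [bot_sup_eq] at h

/-- The thagomizer graph `T_n`: the complete bipartite graph `K_{2,n}` with one additional edge,
joining the two vertices of the part of size two. -/
def thagomizerGraph (n : ℕ) : SimpleGraph (Fin 2 ⊕ Fin n) :=
  completeBipartiteGraph (Fin 2) (Fin n) ⊔ edge (Sum.inl 0) (Sum.inl 1)

end SimpleGraph

/-! ### Kazhdan–Lusztig polynomials of matroids -/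

/-- `f = t ^ d * f (t⁻¹)` as Laurent polynomials. -/
def Polynomial.IsPalindromic (d : ℕ) (f : ℤ[X]) : Prop :=
  f.natDegree ≤ d ∧ ∀ k ≤ d, f.coeff k = f.coeff (d - k)

/-- For `f` of degree at most `d`, the unique polynomial `g` of degree less than `d / 2` such that
`f + g` is palindromic of degree `d`. -/
noncomputable def Polynomial.palCompletion (d : ℕ) (f : ℤ[X]) : ℤ[X] :=
  ∑ i ∈ Finset.range ((d + 1) / 2),
    Polynomial.C (f.coeff (d - i) - f.coeff i) * Polynomial.X ^ i

namespace Matroid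

variable {α : Type*}

/-- The rank of a set in a matroid, as a natural number (used on finite matroids only). -/
noncomputable def rkNat (M : Matroid α) (X : Set α) : ℕ := (M.eRk X).toNat

/-- The rank of a matroid, as a natural number (used on finite matroids only). -/
noncomputable def rankNat (M : Matroid α) : ℕ := M.eRank.toNat

variable [Finite α]

/-- The finite set of flats of a matroid. -/
noncomputable def flats (M : Matroid α) : Finset (Set α) := (Set.toFinite {F | M.IsFlat F}).toFinset

theorem mem_flats {M : Matroid α} {F : Set α} : F ∈ M.flats ↔ M.IsFlat F := by
  simp [flats]

/-- The flats other than the minimal one, which is the set of loops (empty for loopless `M`). -/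
noncomputable def posFlats (M : Matroid α) : Finset (Set α) :=
  (Set.toFinite {F | M.IsFlat F ∧ F ≠ M.loops}).toFinset

theorem mem_posFlats {M : Matroid α} {F : Set α} :
    F ∈ M.posFlats ↔ M.IsFlat F ∧ F ≠ M.loops := by
  simp [posFlats]

theorem ncard_contract_lt {M : Matroid α} {F : Set α} (hF : F ∈ M.posFlats) :
    (M ／ F).E.ncard < M.E.ncard := by
  rw [mem_posFlats] at hF
  obtain ⟨e, he⟩ : F.Nonempty := by
    rw [Set.nonempty_iff_ne_empty]
    rintro rfl
    exact hF.2 (Set.subset_empty_iff.1 hF.1.loops_subset).symm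
  exact Set.ncard_lt_ncard ((Set.ssubset_iff_of_subset (M.contract_ground_subset_ground F)).2
    ⟨e, hF.1.subset_ground he, fun h => h.2 he⟩) (Set.toFinite _)

/-- The Kazhdan–Lusztig polynomial of a matroid. It depends only on the lattice of flats; on
loopless matroids it is the unique family of polynomials with `P_M = 1` in rank zero,
`deg P_M < rk M / 2` in positive rank and `∑_F t ^ rk F * P_{M ／ F}` palindromic of degree `rk M`;
see `Matroid.isKLFamily_klPoly` and `Matroid.IsKLFamily.eq_klPoly`. -/
noncomputable def klPoly (M : Matroid α) : ℤ[X] :=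
  open Classical in
  if M.rankNat = 0 then 1 else
    Polynomial.palCompletion M.rankNat
      (∑ F ∈ M.posFlats.attach, Polynomial.X ^ M.rkNat F.1 * klPoly (M ／ F.1))
termination_by M.E.ncard
decreasing_by exact ncard_contract_lt F.2

/-- The polynomial `Z_M = ∑_F t ^ rk F * P_{M ／ F}` attached to a family of polynomials `P`. -/
noncomputable def zPolyOf (P : Matroid α → ℤ[X]) (M : Matroid α) : ℤ[X] :=
  ∑ F ∈ M.flats, Polynomial.X ^ M.rkNat F * P (M ／ F)

/-- The properties that characterize the Kazhdan–Lusztig polynomials of loopless matroids. -/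
structure IsKLFamily (P : Matroid α → ℤ[X]) : Prop where
  rank_zero : ∀ M : Matroid α, M.Loopless → M.rankNat = 0 → P M = 1
  degree_lt : ∀ M : Matroid α, M.Loopless → 0 < M.rankNat → 2 * (P M).natDegree < M.rankNat
  palindromic : ∀ M : Matroid α, M.Loopless → (zPolyOf P M).IsPalindromic M.rankNat

end Matroid

/-! ### The characterization of the Kazhdan–Lusztig polynomials -/

namespace Polynomial

theorem coeff_palCompletion (d : ℕ) (f : ℤ[X]) (k : ℕ) :
    (palCompletion d f).coeff k = if 2 * k < d then f.coeff (d - k) - f.coeff k else 0 := by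
  simp only [palCompletion, finsetSum_coeff, coeff_C_mul, coeff_X_pow, mul_ite, mul_one, mul_zero,
    Finset.sum_ite_eq, Finset.mem_range]
  congr 1
  apply propext
  omega

theorem natDegree_palCompletion {d : ℕ} (hd : 0 < d) (f : ℤ[X]) :
    2 * (palCompletion d f).natDegree < d := by
  by_contra h
  have h0 : palCompletion d f = 0 := by
    rw [← leadingCoeff_eq_zero, leadingCoeff, coeff_palCompletion, if_neg h]
  rw [h0] at h
  simp at h
  omega

theorem isPalindromic_add_palCompletion {d : ℕ} {f : ℤ[X]} (hf : f.natDegree ≤ d) :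
    (palCompletion d f + f).IsPalindromic d := by
  constructor
  · refine natDegree_add_le_of_degree_le ?_ hf
    rcases Nat.eq_zero_or_pos d with rfl | hd
    · simp [palCompletion]
    · have := natDegree_palCompletion hd f
      omega
  · intro k hk
    simp only [coeff_add, coeff_palCompletion]
    have : d - (d - k) = k := by omega
    rw [this]
    rcases lt_trichotomy (2 * k) d with h | h | h
    · rw [if_pos h, if_neg (by omega)]
      ring
    · have : d - k = k := by omega
      rw [this]
    · rw [if_neg (by omega), if_pos (by omega)]
      ring

theorem IsPalindromic.eq_of_add {d : ℕ} {f p q : ℤ[X]} (hp : 2 * p.natDegree < d)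
    (hq : 2 * q.natDegree < d) (h1 : (p + f).IsPalindromic d) (h2 : (q + f).IsPalindromic d) :
    p = q := by
  ext k
  rcases lt_or_ge (2 * k) d with h | h
  · have e1 := h1.2 k (by omega)
    have e2 := h2.2 k (by omega)
    simp only [coeff_add] at e1 e2
    rw [coeff_eq_zero_of_natDegree_lt (p := p) (n := d - k) (by omega)] at e1
    rw [coeff_eq_zero_of_natDegree_lt (p := q) (n := d - k) (by omega)] at e2
    linarith
  · rw [coeff_eq_zero_of_natDegree_lt (p := p) (by omega),
      coeff_eq_zero_of_natDegree_lt (p := q) (by omega)]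

end Polynomial

namespace Matroid

variable {α : Type*}

theorem IsFlat.loopless_contract {M : Matroid α} {F : Set α} (hF : M.IsFlat F) :
    (M ／ F).Loopless :=
  ⟨by rw [contract_loops_eq, hF.closure, Set.sdiff_self]⟩

variable [Finite α]

theorem rkNat_add_rankNat_contract {M : Matroid α} {F : Set α} (hF : F ⊆ M.E) :
    M.rkNat F + (M ／ F).rankNat = M.rankNat := by
  obtain ⟨I, hI⟩ := M.exists_isBasis F hF
  obtain ⟨B, hB, hIB⟩ := hI.indep.exists_isBase_superset
  have hBF : B ∩ F = I := (hI.eq_of_subset_indep (hB.indep.inter_right F)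
    (Set.subset_inter hIB hI.subset) Set.inter_subset_right).symm
  have hb : (M ／ F).IsBasis (B \ F) (M.E \ F) := by
    refine hB.isBasis_ground.contract_isBasis hI (hB.indep.subset ?_)
    exact Set.union_subset Set.sdiff_subset hIB
  have hb' : (M ／ F).IsBase (B \ F) := isBasis_ground_iff.1 hb
  rw [rkNat, rankNat, rankNat, ← hI.encard_eq_eRk, ← hb'.encard_eq_eRank, ← hB.encard_eq_eRank,
    ← hBF, ← ENat.toNat_add (Set.toFinite _).encard_lt_top.ne (Set.toFinite _).encard_lt_top.ne,
    add_comm, Set.encard_sdiff_add_encard_inter]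

theorem klPoly_eq (M : Matroid α) (h : 0 < M.rankNat) :
    M.klPoly = Polynomial.palCompletion M.rankNat
      (∑ F ∈ M.posFlats, Polynomial.X ^ M.rkNat F * klPoly (M ／ F)) := by
  rw [klPoly, if_neg h.ne',
    Finset.sum_attach M.posFlats (fun F => Polynomial.X ^ M.rkNat F * klPoly (M ／ F))]

theorem klPoly_of_rank_zero {M : Matroid α} (h : M.rankNat = 0) : M.klPoly = 1 := by
  rw [klPoly, if_pos h]

theorem natDegree_klPoly_le (M : Matroid α) : M.klPoly.natDegree ≤ M.rankNat := by
  rcases Nat.eq_zero_or_pos M.rankNat with h | h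
  · simp [klPoly_of_rank_zero h]
  · rw [klPoly_eq M h]
    have := Polynomial.natDegree_palCompletion h
      (∑ F ∈ M.posFlats, Polynomial.X ^ M.rkNat F * klPoly (M ／ F))
    omega

theorem zPolyOf_eq (P : Matroid α → ℤ[X]) (M : Matroid α) (hM : M.Loopless) :
    zPolyOf P M = P M + ∑ F ∈ M.posFlats, Polynomial.X ^ M.rkNat F * P (M ／ F) := by
  classical
  have h : M.flats = insert ∅ M.posFlats := by
    ext F
    rw [Finset.mem_insert, mem_flats, mem_posFlats, M.loops_eq_empty]
    have h0 : M.IsFlat ∅ := by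
      rw [← M.loops_eq_empty]
      exact M.isFlat_closure ∅
    by_cases hF : F = ∅
    · simp [hF, h0]
    · simp [hF]
  rw [zPolyOf, h, Finset.sum_insert (by simp [mem_posFlats])]
  simp [rkNat]

/-- The Kazhdan–Lusztig polynomials have the characteristic properties. -/
theorem isKLFamily_klPoly : IsKLFamily (klPoly : Matroid α → ℤ[X]) where
  rank_zero _ _ h := klPoly_of_rank_zero h
  degree_lt M _ h := by
    rw [klPoly_eq M h]
    exact Polynomial.natDegree_palCompletion h _
  palindromic M hM := by
    rw [zPolyOf_eq _ M hM]
    have hdeg : (∑ F ∈ M.posFlats, Polynomial.X ^ M.rkNat F * klPoly (M ／ F)).natDegree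
        ≤ M.rankNat := by
      refine Polynomial.natDegree_sum_le_of_forall_le _ _ fun F hF => ?_
      have h1 := rkNat_add_rankNat_contract (mem_posFlats.1 hF).1.subset_ground
      have h2 := natDegree_klPoly_le (M ／ F)
      refine Polynomial.natDegree_mul_le.trans ?_
      rw [Polynomial.natDegree_X_pow]
      omega
    rcases Nat.eq_zero_or_pos M.rankNat with h | h
    · refine ⟨Polynomial.natDegree_add_le_of_degree_le (natDegree_klPoly_le M) hdeg, ?_⟩
      intro k hk
      congr 1
      omega
    · rw [klPoly_eq M h]
      exact Polynomial.isPalindromic_add_palCompletion hdeg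

/-- The characteristic properties determine the Kazhdan–Lusztig polynomials. -/
theorem IsKLFamily.eq_klPoly {P : Matroid α → ℤ[X]} (hP : IsKLFamily P) (M : Matroid α)
    (hM : M.Loopless) : P M = M.klPoly := by
  induction hn : M.E.ncard using Nat.strong_induction_on generalizing M with
  | _ n ih =>
    subst hn
    rcases Nat.eq_zero_or_pos M.rankNat with h | h
    · rw [hP.rank_zero M hM h, klPoly_of_rank_zero h]
    · have h1 := hP.palindromic M hM
      have h2 := isKLFamily_klPoly.palindromic M hM
      rw [zPolyOf_eq _ M hM] at h1 h2
      have hs : ∑ F ∈ M.posFlats, Polynomial.X ^ M.rkNat F * P (M ／ F) =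
          ∑ F ∈ M.posFlats, Polynomial.X ^ M.rkNat F * klPoly (M ／ F) :=
        Finset.sum_congr rfl fun F hF => by
          rw [ih _ (ncard_contract_lt hF) (M ／ F)
            (mem_posFlats.1 hF).1.loopless_contract rfl]
      rw [hs] at h1
      exact Polynomial.IsPalindromic.eq_of_add (hP.degree_lt M hM h)
        (isKLFamily_klPoly.degree_lt M hM h) h1 h2

end Matroid

/-! Let `M` be the cycle matroid of `T_n` and `e` the edge joining the two hubs, so that `M ＼ {e}`
belongs to `K_{2,n}`. Both matroids have the same rank `d ≥ 3`, and each polynomial is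
`palCompletion d` of a sum over nonempty flats. Sending `G` to `G \ {e}` matches the nonempty flats
of `M` other than `{e}` with those of `M ＼ {e}` (`sum_posFlats_deleteElem`).

Matched terms agree. If `e ∈ G`, then `G \ {e}` already spans `e` and the contractions coincide. If
`e ∉ G`, then `G` contains a spoke at some `i`, and the triangle at `i` makes `e` parallel to the
other spoke in `M ／ G`, where its deletion is harmless (`klPoly_deleteElem_of_parallel`).

The unmatched flat `{e}` contributes `t * P_{M ／ e}`. Contracting `e` leaves `n` parallel pairs,
essentially a free matroid, so this term is `t`; by linearity of the completion it changes the
result by `-t`. -/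

namespace Polynomial

/-! ### Values of the palindromic completion. -/

theorem palCompletion_add (d : ℕ) (f g : ℤ[X]) :
    palCompletion d (f + g) = palCompletion d f + palCompletion d g := by
  ext k
  simp only [coeff_add, coeff_palCompletion]
  split_ifs <;> ring

/-- The bound is sharp: for `d = 2` the polynomial `X` is already palindromic and its completion is
`0`. -/
theorem palCompletion_X {d : ℕ} (hd : 3 ≤ d) : palCompletion d X = -X := by
  ext k
  rw [coeff_palCompletion, coeff_neg, coeff_X, coeff_X]
  split_ifs <;> omega

/-- By symmetry of the binomial coefficients, only the removed constant term has to be restored. -/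
theorem palCompletion_one_add_X_pow {d : ℕ} (hd : 0 < d) :
    palCompletion d ((1 + X) ^ d - 1) = 1 := by
  ext k
  simp only [coeff_palCompletion, coeff_sub, coeff_one_add_X_pow, coeff_one]
  rcases Nat.eq_zero_or_pos k with rfl | hk
  · simp [hd, hd.ne']
  · split_ifs with h
    · omega
    · omega
    · omega
    · rw [Nat.choose_symm (by omega)]
      ring
    · omega
    · rfl

end Polynomial

/-! ### Deletion of one element, parallel elements and free matroids. -/

namespace Matroid

variable {α : Type*} {M : Matroid α} {e f : α} {F G : Set α}

theorem rkNat_closure (M : Matroid α) (X : Set α) : M.rkNat (M.closure X) = M.rkNat X := by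
  rw [rkNat, rkNat, eRk_closure_eq]

theorem rkNat_deleteElem (M : Matroid α) (he : e ∉ F) : (M ＼ {e}).rkNat F = M.rkNat F := by
  have h : F ∩ M.E ⊆ M.E \ {e} := fun x hx => ⟨hx.2, fun h => he (h ▸ hx.1)⟩
  rw [rkNat, rkNat, ← eRk_inter_ground, delete_ground, delete_eq_restrict, restrict_eRk_eq _
    Set.inter_subset_right, ← M.eRk_inter_ground F]
  congr 2
  ext x
  exact ⟨fun hx => ⟨hx.1, hx.2.1⟩, fun hx => ⟨hx.1, h hx⟩⟩

theorem rankNat_deleteElem (h : e ∈ M.closure (M.E \ {e})) :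
    (M ＼ {e}).rankNat = M.rankNat := by
  rw [rankNat, rankNat, delete_eq_restrict, eRank_restrict, ← eRk_closure_eq,
    closure_sdiff_singleton_eq_closure h, closure_ground, eRk_ground]

theorem IsFlat.deleteElem (hG : M.IsFlat G) (e : α) : (M ＼ {e}).IsFlat (G \ {e}) := by
  rw [isFlat_iff_closure_eq, delete_closure_eq_of_disjoint _ Set.disjoint_sdiff_left]
  refine subset_antisymm (Set.sdiff_subset_sdiff_left ?_) fun x hx => ⟨?_, hx.2⟩
  · exact (M.closure_subset_closure Set.sdiff_subset).trans hG.closure.subset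
  · exact M.mem_closure_of_mem' ⟨hx.1, hx.2⟩ (hG.subset_ground hx.1)

theorem IsFlat.closure_sdiff_of_deleteElem (hF : (M ＼ {e}).IsFlat F) :
    M.closure F \ {e} = F := by
  have h := hF.closure
  rwa [delete_closure_eq_of_disjoint] at h
  exact Set.disjoint_singleton_right.2 fun he => (hF.subset_ground he).2 rfl

/-- With `IsFlat.closure_sdiff_of_deleteElem`, this makes closure and removal of `e` mutually
inverse on the flats in which `e` is not a coloop. -/
theorem IsFlat.closure_sdiff_singleton (hG : M.IsFlat G) (h : e ∈ G → e ∈ M.closure (G \ {e})) :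
    M.closure (G \ {e}) = G := by
  by_cases he : e ∈ G
  · rw [closure_sdiff_singleton_eq_closure (h he), hG.closure]
  · rw [Set.sdiff_singleton_eq_self he, hG.closure]

/-- Contracting a set `G` which is spanned by `G \ {e}` and contains `e` does the same as deleting
`e` and contracting `G \ {e}`. -/
theorem deleteElem_contract_sdiff (heG : e ∈ G) (he : e ∈ M.closure (G \ {e})) :
    M ＼ {e} ／ (G \ {e}) = M ／ G := by
  have h : {e} ⊆ (M ／ (G \ {e})).loops := by
    rw [contract_loops_eq, Set.singleton_subset_iff]
    exact ⟨he, fun h => h.2 rfl⟩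
  rw [← contract_delete_comm _ Set.disjoint_sdiff_left, ← contract_eq_delete_of_subset_loops h,
    contract_contract, Set.sdiff_union_of_subset (Set.singleton_subset_iff.2 heG)]

theorem Loopless.deleteElem (hM : M.Loopless) (e : α) : (M ＼ {e}).Loopless :=
  ⟨by rw [delete_loops_eq, M.loops_eq_empty, Set.empty_sdiff]⟩

variable [Finite α]

/-- A sum over the nonempty flats of `M ＼ {e}` as a sum over those nonempty flats of `M` in
which `e` is not a coloop. -/
theorem sum_posFlats_deleteElem (hM : M.Loopless) (φ : Set α → ℤ[X]) (s : Finset (Set α))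
    (hs : ∀ G, G ∈ s ↔ M.IsFlat G ∧ G ≠ ∅ ∧ (e ∈ G → e ∈ M.closure (G \ {e}))) :
    ∑ G ∈ s, Polynomial.X ^ M.rkNat G * φ (G \ {e}) =
      ∑ F ∈ (M ＼ {e}).posFlats, Polynomial.X ^ (M ＼ {e}).rkNat F * φ F := by
  have hl := hM.deleteElem e
  refine Finset.sum_nbij' (fun G => G \ {e}) M.closure ?_ ?_ ?_ ?_ ?_
  · intro G hG
    obtain ⟨h1, h2, h3⟩ := (hs G).1 hG
    rw [mem_posFlats, loops_eq_empty]
    refine ⟨h1.deleteElem e, fun h => h2 ?_⟩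
    rw [← h1.closure_sdiff_singleton h3, h]
    exact M.loops_eq_empty
  · intro F hF
    rw [mem_posFlats, loops_eq_empty] at hF
    have h := hF.1.closure_sdiff_of_deleteElem
    rw [hs]
    refine ⟨M.isFlat_closure F, fun h0 => hF.2 ?_, fun he => ?_⟩
    · rw [← h, h0, Set.empty_sdiff]
    · rwa [h]
  · intro G hG
    obtain ⟨h1, h2, h3⟩ := (hs G).1 hG
    exact h1.closure_sdiff_singleton h3
  · intro F hF
    exact (mem_posFlats.1 hF).1.closure_sdiff_of_deleteElem
  · intro G hG
    obtain ⟨h1, h2, h3⟩ := (hs G).1 hG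
    rw [rkNat_deleteElem M (fun h => h.2 rfl), ← rkNat_closure M (G \ {e}),
      h1.closure_sdiff_singleton h3]

/-- Deleting an element parallel to another one does not change the Kazhdan–Lusztig polynomial. -/
theorem klPoly_deleteElem_of_parallel (hM : M.Loopless) (hef : e ≠ f)
    (he : e ∈ M.closure {f}) : (M ＼ {e}).klPoly = M.klPoly := by
  induction hn : M.E.ncard using Nat.strong_induction_on generalizing M with
  | _ n ih =>
    subst hn
    have heE : e ∈ M.E := M.mem_ground_of_mem_closure he
    -- Exchange makes the relation symmetric, since `e` is not a loop.
    have hfe : f ∈ M.closure {e} := by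
      have := M.mem_closure_insert (X := ∅) (e := e) (f := f)
      rw [insert_empty_eq, insert_empty_eq] at this
      refine this ?_ he
      exact fun h => M.loops_eq_empty.subset h
    have hfE : f ∈ M.E := M.mem_ground_of_mem_closure hfe
    -- A flat through `e` also contains `f`, which spans `e`; hence no flat is lost in the
    -- reindexing.
    have hcl : ∀ G, M.IsFlat G → e ∈ G → e ∈ M.closure (G \ {e}) := by
      intro G hG heG
      have hfG : f ∈ G := by
        rw [← hG.closure]
        exact M.closure_subset_closure (Set.singleton_subset_iff.2 heG) hfe
      exact M.closure_subset_closure (Y := G \ {e})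
        (Set.singleton_subset_iff.2 ⟨hfG, hef.symm⟩) he
    have hr : (M ＼ {e}).rankNat = M.rankNat :=
      rankNat_deleteElem (hcl _ M.ground_isFlat heE)
    rcases Nat.eq_zero_or_pos M.rankNat with h0 | h0
    · rw [klPoly_of_rank_zero h0, klPoly_of_rank_zero (hr.trans h0)]
    · rw [klPoly_eq M h0, klPoly_eq _ (hr ▸ h0), hr]
      congr 1
      rw [← sum_posFlats_deleteElem hM (fun F => (M ＼ {e} ／ F).klPoly) M.posFlats]
      · refine Finset.sum_congr rfl fun G hG => ?_
        have hGf := (mem_posFlats.1 hG).1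
        congr 1
        by_cases heG : e ∈ G
        · rw [deleteElem_contract_sdiff heG (hcl G hGf heG)]
        · rw [Set.sdiff_singleton_eq_self heG, ← contract_delete_comm _
            (Set.disjoint_singleton_right.2 heG)]
          -- `e` stays in the closure of `f` after contracting `G`, and is no loop there since `G`
          -- is a flat avoiding `e`.
          refine ih _ (ncard_contract_lt hG) hGf.loopless_contract ?_ rfl
          rw [contract_closure_eq]
          exact ⟨M.closure_subset_closure Set.subset_union_left he, heG⟩
      · intro G
        rw [mem_posFlats, M.loops_eq_empty]
        exact ⟨fun h => ⟨h.1, h.2, hcl G h.1⟩, fun h => ⟨h.1, h.2.1⟩⟩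

/-- Each partner `f` lies outside all of `D`, so it survives the deletions made one element at a
time. -/
theorem klPoly_delete_of_parallel (hM : M.Loopless) (D : Set α)
    (hD : ∀ e ∈ D, ∃ f ∉ D, e ∈ M.closure {f}) : (M ＼ D).klPoly = M.klPoly := by
  induction D, Set.toFinite D using Set.Finite.induction_on generalizing M with
  | empty => rw [delete_empty]
  | @insert e D heD _ ih =>
    obtain ⟨f, hf, he⟩ := hD e (Set.mem_insert _ _)
    rw [Set.insert_eq, ← delete_delete, ih (hM.deleteElem e), klPoly_deleteElem_of_parallel hM _ he]
    · rintro rfl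
      exact hf (Set.mem_insert _ _)
    · intro x hx
      obtain ⟨y, hy, hxy⟩ := hD x (Set.mem_insert_of_mem _ hx)
      refine ⟨y, fun h => hy (Set.mem_insert_of_mem _ h), ?_⟩
      rw [delete_closure_eq_of_disjoint]
      · exact ⟨hxy, fun h => heD (Set.mem_singleton_iff.1 h ▸ hx)⟩
      · rw [Set.disjoint_singleton]
        rintro rfl
        exact hy (Set.mem_insert _ _)

/-- The Kazhdan–Lusztig polynomial of a free matroid is `1`. -/
theorem klPoly_of_indep_ground (hM : M.Indep M.E) : M.klPoly = 1 := by
  induction hn : M.E.ncard using Nat.strong_induction_on generalizing M with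
  | _ n ih =>
    subst hn
    obtain ⟨E, rfl⟩ : ∃ E, M = freeOn E := ⟨M.E, eq_freeOn_iff.2 ⟨rfl, hM⟩⟩
    have hl : (freeOn E).loops = ∅ := by
      rw [loops, freeOn_closure_eq, Set.empty_inter]
    have hrk : ∀ F ⊆ E, (freeOn E).rkNat F = F.ncard := fun F hF => by
      rw [rkNat, eRk_freeOn hF, Set.ncard_def]
    have hrank : (freeOn E).rankNat = E.ncard := by
      rw [rankNat, eRank_freeOn, Set.ncard_def]
    rcases Nat.eq_zero_or_pos (freeOn E).rankNat with h0 | h0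
    · exact klPoly_of_rank_zero h0
    rw [klPoly_eq _ h0, hrank]
    rw [hrank] at h0
    -- Every subset is a flat with free contraction, so by induction the sum is that of `t ^ |F|`
    -- over nonempty `F`, which is `(1 + t) ^ d - 1`.
    rw [← Polynomial.palCompletion_one_add_X_pow h0]
    congr 1
    rw [eq_sub_iff_add_eq']
    have h1 : ∀ F ∈ (freeOn E).posFlats, Polynomial.X ^ (freeOn E).rkNat F *
        ((freeOn E) ／ F).klPoly = Polynomial.X ^ F.ncard := by
      intro F hF
      have hFE := (mem_posFlats.1 hF).1.subset_ground
      rw [ih _ (ncard_contract_lt hF) _ rfl, mul_one, hrk F hFE]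
      rw [(show (freeOn E).Indep F from freeOn_indep hFE).contract_indep_iff]
      exact ⟨Set.disjoint_sdiff_left, freeOn_indep (Set.union_subset Set.sdiff_subset hFE)⟩
    rw [Finset.sum_congr rfl h1]
    classical
    have h2 := Finset.sum_pow_mul_eq_add_pow (Polynomial.X : ℤ[X]) 1 (Set.toFinite E).toFinset
    simp only [one_pow, mul_one] at h2
    rw [← Set.ncard_eq_toFinset_card, add_comm Polynomial.X] at h2
    rw [← h2, ← Finset.sum_erase_add _ _ (Finset.empty_mem_powerset _), Finset.card_empty, pow_zero,
      add_comm]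
    congr 1
    refine Finset.sum_nbij' (fun F => (Set.toFinite F).toFinset) (fun s => (s : Set α)) ?_ ?_ ?_ ?_ ?_
    · intro F hF
      rw [mem_posFlats, hl] at hF
      simpa [Set.nonempty_iff_ne_empty] using ⟨hF.2, hF.1.subset_ground⟩
    · intro s hs
      rw [mem_posFlats, hl]
      simp only [Finset.mem_erase, Finset.mem_powerset, Set.Finite.subset_toFinset] at hs
      refine ⟨?_, by simpa using hs.1⟩
      rw [isFlat_iff_closure_eq, freeOn_closure_eq, Set.inter_eq_left.2 hs.2]
    · intro F _
      simp
    · intro s _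
      simp
    · intro F _
      rw [Set.ncard_eq_toFinset_card]

end Matroid

/-! ### Stars and triangles in cycle matroids; edges of the thagomizer graph. -/

namespace SimpleGraph

open scoped Matroid

variable {V : Type*} (G : SimpleGraph V)

/-- Edges through a common vertex form part of a star, which is acyclic. -/
theorem cycleMatroid_indep_of_forall_mem {I : Set (Sym2 V)} (r : V) (hI : I ⊆ G.edgeSet)
    (h : ∀ e ∈ I, r ∈ e) : G.cycleMatroid.Indep I := by
  refine (G.cycleMatroid_indep_iff I).2 ⟨hI, (isAcyclic_starGraph r).anti fun u v huv => ?_⟩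
  rw [fromEdgeSet_adj] at huv
  rw [starGraph_adj]
  have := h _ huv.1
  rw [Sym2.mem_iff] at this
  exact ⟨huv.2, this.imp Eq.symm Eq.symm⟩

variable {G}

/-- Two sides form a star at `y`, hence a forest; the third side completes a 3-clique, which no
forest contains. -/
theorem mem_closure_cycleMatroid_of_triangle {x y z : V} (hxy : G.Adj x y) (hyz : G.Adj y z)
    (hxz : G.Adj x z) : s(x, z) ∈ G.cycleMatroid.closure {s(x, y), s(y, z)} := by
  have hI : G.cycleMatroid.Indep {s(x, y), s(y, z)} :=
    G.cycleMatroid_indep_of_forall_mem y (by rintro _ (rfl | rfl) <;> assumption)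
      (by rintro _ (rfl | rfl) <;> simp)
  rw [hI.mem_closure_iff]
  refine Or.inl ⟨fun h => ?_, ?_⟩
  · have h3 := ((G.cycleMatroid_indep_iff _).1 h).2.cliqueFree le_rfl
    classical
    refine h3 {x, y, z} (is3Clique_triple_iff.2 ?_)
    simp [fromEdgeSet_adj, hxy.ne, hyz.ne, hxz.ne]
  · rintro _ (rfl | rfl | rfl) <;> assumption

theorem cycleMatroid_sup_edge_deleteElem {u v : V} (huv : u ≠ v) (h : ¬ G.Adj u v) :
    (G ⊔ edge u v).cycleMatroid ＼ {s(u, v)} = G.cycleMatroid := by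
  have hE : (G ⊔ edge u v).edgeSet \ {s(u, v)} = G.edgeSet := by
    rw [edgeSet_sup, edgeSet_edge_of_ne huv, Set.union_sdiff_right,
      Set.sdiff_singleton_eq_self (G.mem_edgeSet.not.2 h)]
  refine Matroid.ext_indep hE fun I hI => ?_
  have hI' : I ⊆ (G ⊔ edge u v).edgeSet \ {s(u, v)} := hI
  rw [Matroid.deleteElem_indep_iff, cycleMatroid_indep_iff, cycleMatroid_indep_iff]
  refine ⟨fun h => ⟨hE ▸ hI', h.1.2⟩, fun h => ⟨⟨fun x hx => (hI' hx).1, h.2⟩, fun hx => ?_⟩⟩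
  exact (hI' hx).2 rfl

variable {n : ℕ}

theorem thagomizerGraph_adj_inl_inr (c : Fin 2) (i : Fin n) :
    (thagomizerGraph n).Adj (Sum.inl c) (Sum.inr i) :=
  Or.inl (by simp)

theorem thagomizerGraph_adj_inl {c d : Fin 2} (h : c ≠ d) :
    (thagomizerGraph n).Adj (Sum.inl c) (Sum.inl d) := by
  refine Or.inr ?_
  rw [edge_adj]
  fin_cases c <;> fin_cases d <;> simp at h ⊢

theorem mem_edgeSet_thagomizerGraph {x : Sym2 (Fin 2 ⊕ Fin n)}
    (hx : x ∈ (thagomizerGraph n).edgeSet) :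
    x = s(Sum.inl 0, Sum.inl 1) ∨ ∃ c i, x = s(Sum.inl c, Sum.inr i) := by
  induction x with
  | _ u v =>
    rcases hx with h | h
    · rw [completeBipartiteGraph_adj] at h
      rcases u with u | u <;> rcases v with v | v <;> simp at h
      · exact Or.inr ⟨u, v, rfl⟩
      · exact Or.inr ⟨v, u, Sym2.eq_swap⟩
    · rw [edge_adj] at h
      left
      rcases h.1 with ⟨rfl, rfl⟩ | ⟨rfl, rfl⟩
      · rfl
      · exact Sym2.eq_swap

end SimpleGraph

/-! ### Comparison of the recursions for `M` and `M ＼ {e}`. -/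

namespace Matroid

variable {α : Type*} [Finite α] {M : Matroid α} {e : α}

theorem Indep.ncard_le_rankNat {I : Set α} (hI : M.Indep I) : I.ncard ≤ M.rankNat := by
  refine ENat.toNat_le_toNat hI.encard_le_eRank ?_
  exact (M.eRank_le_encard_ground.trans_lt (Set.toFinite _).encard_lt_top).ne

/-- If `e` is not a coloop of any flat except `{e}` and `P_{M ／ e} = 1`, deleting `e` adds `t` to the
Kazhdan–Lusztig polynomial, provided the contractions by the other flats without `e` are
insensitive to the deletion of `e`. -/
theorem klPoly_eq_klPoly_deleteElem_sub_X (hM : M.Loopless) (hr : 3 ≤ M.rankNat)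
    (heE : e ∈ M.closure (M.E \ {e})) (he : M.IsFlat {e}) (h1 : (M ／ {e}).klPoly = 1)
    (hcl : ∀ G, M.IsFlat G → e ∈ G → G ≠ {e} → e ∈ M.closure (G \ {e}))
    (hdel : ∀ G, M.IsFlat G → G ≠ ∅ → e ∉ G → (M ／ G ＼ {e}).klPoly = (M ／ G).klPoly) :
    M.klPoly = (M ＼ {e}).klPoly - Polynomial.X := by
  classical
  have hr' : (M ＼ {e}).rankNat = M.rankNat := rankNat_deleteElem heE
  have hmem : {e} ∈ M.posFlats := by
    rw [mem_posFlats, M.loops_eq_empty]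
    exact ⟨he, Set.singleton_ne_empty e⟩
  have hrk : M.rkNat {e} = 1 := by
    rw [rkNat, eRk_singleton_eq (M.mem_ground_of_mem_closure heE), ENat.toNat_one]
  -- The flat `{e}` is split off: its term is `t`, with completion `-t` because the rank is at least
  -- `3`.
  rw [klPoly_eq M (by omega), klPoly_eq (M ＼ {e}) (by omega), hr',
    ← Finset.sum_erase_add _ _ hmem, h1, hrk, pow_one, mul_one, Polynomial.palCompletion_add,
    Polynomial.palCompletion_X hr, ← sub_eq_add_neg]
  congr 2
  rw [← sum_posFlats_deleteElem hM (fun F => (M ＼ {e} ／ F).klPoly) (M.posFlats.erase {e})]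
  · refine Finset.sum_congr rfl fun G hG => ?_
    rw [Finset.mem_erase, mem_posFlats, M.loops_eq_empty] at hG
    congr 1
    by_cases heG : e ∈ G
    · rw [deleteElem_contract_sdiff heG (hcl G hG.2.1 heG hG.1)]
    · rw [Set.sdiff_singleton_eq_self heG, ← contract_delete_comm _
        (Set.disjoint_singleton_right.2 heG), hdel G hG.2.1 hG.2.2 heG]
  · intro G
    rw [Finset.mem_erase, mem_posFlats, M.loops_eq_empty]
    refine ⟨fun h => ⟨h.2.1, h.2.2, fun heG => hcl G h.2.1 heG h.1⟩,
      fun h => ⟨?_, h.1, h.2.1⟩⟩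
    -- The flat `{e}` is excluded by the coloop condition: otherwise `e` would lie in the closure of
    -- `∅` and be a loop.
    rintro rfl
    have := h.2.2 rfl
    rw [Set.sdiff_self] at this
    exact M.loops_eq_empty.subset this

end Matroid

/-! ### The thagomizer graph. -/

namespace SimpleGraph

open scoped Matroid

variable {n : ℕ}

/-- This makes the two spokes at `i` parallel once the edge between the hubs is contracted. -/
theorem mem_closure_thagomizerGraph (i : Fin n) (c d : Fin 2) :
    s(Sum.inl d, Sum.inr i) ∈ (thagomizerGraph n).cycleMatroid.closure
      {s(Sum.inl 0, Sum.inl 1), s(Sum.inl c, Sum.inr i)} := by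
  rcases eq_or_ne d c with rfl | h
  · exact Matroid.mem_closure_of_mem' _ (Set.mem_insert_of_mem _ rfl)
      (thagomizerGraph_adj_inl_inr d i)
  · have h2 : (s(Sum.inl 0, Sum.inl 1) : Sym2 (Fin 2 ⊕ Fin n)) = s(Sum.inl d, Sum.inl c) := by
      fin_cases c <;> fin_cases d <;> first | exact absurd rfl h | rfl | exact Sym2.eq_swap
    rw [h2]
    exact mem_closure_cycleMatroid_of_triangle (thagomizerGraph_adj_inl h)
      (thagomizerGraph_adj_inl_inr c i) (thagomizerGraph_adj_inl_inr d i)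

theorem mem_closure_thagomizerGraph_of_ne (i : Fin n) {c d : Fin 2} (h : c ≠ d) :
    s(Sum.inl 0, Sum.inl 1) ∈ (thagomizerGraph n).cycleMatroid.closure
      {s(Sum.inl c, Sum.inr i), s(Sum.inl d, Sum.inr i)} := by
  have h2 : (s(Sum.inl 0, Sum.inl 1) : Sym2 (Fin 2 ⊕ Fin n)) = s(Sum.inl c, Sum.inl d) := by
    fin_cases c <;> fin_cases d <;> first | exact absurd rfl h | rfl | exact Sym2.eq_swap
  rw [h2, Sym2.eq_swap (a := Sum.inl d)]
  exact mem_closure_cycleMatroid_of_triangle (thagomizerGraph_adj_inl_inr c i)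
    (thagomizerGraph_adj_inl_inr d i).symm (thagomizerGraph_adj_inl h)

theorem isFlat_singleton_thagomizerGraph :
    (thagomizerGraph n).cycleMatroid.IsFlat {s(Sum.inl 0, Sum.inl 1)} := by
  have heE : (thagomizerGraph n).Adj (Sum.inl 0) (Sum.inl 1) := thagomizerGraph_adj_inl (by simp)
  rw [Matroid.isFlat_iff_closure_eq]
  refine subset_antisymm (fun x hx => ?_) (Set.singleton_subset_iff.2
    (Matroid.mem_closure_self _ _ heE))
  by_contra hne
  have hxE := Matroid.mem_ground_of_mem_closure hx
  obtain rfl | ⟨c, i, rfl⟩ := mem_edgeSet_thagomizerGraph hxE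
  · exact hne rfl
  -- A spoke shares a hub with the edge between the hubs, so the two form a star.
  have hI : (thagomizerGraph n).cycleMatroid.Indep
      (insert s(Sum.inl c, Sum.inr i) {s(Sum.inl 0, Sum.inl 1)}) := by
    refine cycleMatroid_indep_of_forall_mem _ (Sum.inl c) ?_ ?_
    · rintro _ (rfl | rfl) <;> assumption
    · rintro _ (rfl | rfl)
      · simp
      · fin_cases c <;> simp
  exact (((hI.subset (Set.subset_insert _ _)).mem_closure_iff_of_notMem hne).1 hx).not_indep hI

/-- Keep one spoke from each parallel pair, the one at hub `0`. Together with the contracted edge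
these form a star, so what remains is free. -/
theorem klPoly_contract_thagomizerGraph :
    ((thagomizerGraph n).cycleMatroid ／ {s(Sum.inl 0, Sum.inl 1)}).klPoly = 1 := by
  have heE : (thagomizerGraph n).Adj (Sum.inl 0) (Sum.inl 1) := thagomizerGraph_adj_inl (by simp)
  have hl := (thagomizerGraph n).cycleMatroid_loopless
  rw [← Matroid.klPoly_delete_of_parallel isFlat_singleton_thagomizerGraph.loopless_contract
    (Set.range fun i : Fin n => s(Sum.inl 1, Sum.inr i)) ?_]
  · refine Matroid.klPoly_of_indep_ground ?_
    have he : (thagomizerGraph n).cycleMatroid.IsNonloop s(Sum.inl 0, Sum.inl 1) :=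
      Matroid.isNonloop_of_loopless heE
    rw [Matroid.delete_indep_iff, he.contractElem_indep_iff]
    refine ⟨⟨fun h => h.1.2 rfl, cycleMatroid_indep_of_forall_mem _ (Sum.inl 0) ?_ ?_⟩,
      Set.disjoint_sdiff_left⟩
    · exact Set.insert_subset heE fun x hx => hx.1.1
    · rintro x (rfl | hx)
      · simp
      · obtain rfl | ⟨c, i, rfl⟩ := mem_edgeSet_thagomizerGraph hx.1.1
        · simp
        · fin_cases c
          · simp
          · exact absurd ⟨i, rfl⟩ hx.2
  · rintro _ ⟨i, rfl⟩
    refine ⟨s(Sum.inl 0, Sum.inr i), by simp, ?_⟩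
    rw [Matroid.contract_closure_eq, Set.union_comm, Set.singleton_union]
    exact ⟨mem_closure_thagomizerGraph i 0 1, by simp⟩

theorem three_le_rankNat_thagomizerGraph (hn : 2 ≤ n) :
    3 ≤ (thagomizerGraph n).cycleMatroid.rankNat := by
  let f : Fin 3 → Fin 2 ⊕ Fin n :=
    ![Sum.inl 1, Sum.inr ⟨0, by omega⟩, Sum.inr ⟨1, by omega⟩]
  have hI : (thagomizerGraph n).cycleMatroid.Indep (Set.range fun k => s(Sum.inl 0, f k)) := by
    refine cycleMatroid_indep_of_forall_mem _ (Sum.inl 0) ?_ ?_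
    · rintro _ ⟨k, rfl⟩
      fin_cases k
      · exact thagomizerGraph_adj_inl (by simp)
      · exact thagomizerGraph_adj_inl_inr _ _
      · exact thagomizerGraph_adj_inl_inr _ _
    · rintro _ ⟨k, rfl⟩
      simp
  have hf : Function.Injective fun k => s(Sum.inl 0, f k) := by
    intro k l h
    have h' := Sym2.congr_right.1 h
    fin_cases k <;> fin_cases l <;> simp [f] at h' ⊢
  have h := hI.ncard_le_rankNat
  rwa [← Set.image_univ, Set.ncard_image_of_injective _ hf, Set.ncard_univ, Nat.card_fin] at h

theorem klPoly_thagomizerGraph (hn : 2 ≤ n) :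
    (thagomizerGraph n).cycleMatroid.klPoly =
      (completeBipartiteGraph (Fin 2) (Fin n)).cycleMatroid.klPoly - Polynomial.X := by
  have hl := (thagomizerGraph n).cycleMatroid_loopless
  have hdel := cycleMatroid_sup_edge_deleteElem (G := completeBipartiteGraph (Fin 2) (Fin n))
    (u := Sum.inl 0) (v := Sum.inl 1) (by simp) (by simp)
  have hmem : ∀ G, (thagomizerGraph n).cycleMatroid.IsFlat G → ∀ i : Fin n, ∀ c d,
      c ≠ d → s(Sum.inl c, Sum.inr i) ∈ G → s(Sum.inl d, Sum.inr i) ∈ G →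
        s(Sum.inl 0, Sum.inl 1) ∈ G := by
    intro G hG i c d hcd hc hd
    rw [← hG.closure]
    exact Matroid.closure_subset_closure _ (Set.insert_subset hc (Set.singleton_subset_iff.2 hd))
      (mem_closure_thagomizerGraph_of_ne i hcd)
  have hcl : ∀ G, (thagomizerGraph n).cycleMatroid.IsFlat G → s(Sum.inl 0, Sum.inl 1) ∈ G →
      G ≠ {s(Sum.inl 0, Sum.inl 1)} →
        s(Sum.inl 0, Sum.inl 1) ∈
          (thagomizerGraph n).cycleMatroid.closure (G \ {s(Sum.inl 0, Sum.inl 1)}) := by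
    intro G hG heG hne
    -- A flat containing `e` and one spoke at `i` also contains the other, and these two spokes span
    -- `e`.
    obtain ⟨x, hxG, hx⟩ : ∃ x ∈ G, x ≠ s(Sum.inl 0, Sum.inl 1) := by
      by_contra! hcon
      exact hne (subset_antisymm hcon (Set.singleton_subset_iff.2 heG))
    obtain rfl | ⟨c, i, rfl⟩ := mem_edgeSet_thagomizerGraph (hG.subset_ground hxG)
    · exact absurd rfl hx
    have hd : ∀ d, s(Sum.inl d, Sum.inr i) ∈ G \ {s(Sum.inl 0, Sum.inl 1)} := by
      refine fun d => ⟨?_, by simp⟩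
      rw [← hG.closure]
      exact Matroid.closure_subset_closure _
        (Set.insert_subset heG (Set.singleton_subset_iff.2 hxG)) (mem_closure_thagomizerGraph i c d)
    exact Matroid.closure_subset_closure _
      (Set.insert_subset (hd 0) (Set.singleton_subset_iff.2 (hd 1)))
      (mem_closure_thagomizerGraph_of_ne i (by simp))
  rw [← hdel]
  refine Matroid.klPoly_eq_klPoly_deleteElem_sub_X hl (three_le_rankNat_thagomizerGraph hn) ?_
    isFlat_singleton_thagomizerGraph klPoly_contract_thagomizerGraph hcl ?_
  -- The ground set is a flat other than `{e}`, since it contains a spoke.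
  · refine hcl _ (Matroid.ground_isFlat _) (thagomizerGraph_adj_inl (by simp)) fun h => ?_
    have h1 : s(Sum.inl 0, Sum.inr ⟨0, by omega⟩) ∈ (thagomizerGraph n).edgeSet :=
      thagomizerGraph_adj_inl_inr _ _
    have h2 := h.subset h1
    simp at h2
  · intro G hG hne heG
    obtain ⟨x, hxG⟩ := Set.nonempty_iff_ne_empty.2 hne
    obtain rfl | ⟨c, i, rfl⟩ := mem_edgeSet_thagomizerGraph (hG.subset_ground hxG)
    · exact absurd hxG heG
    obtain ⟨d, hcd⟩ : ∃ d, c ≠ d := ⟨c + 1, by fin_cases c <;> simp⟩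
    -- Since `G` contains the spoke from `c` to `i`, the triangle at `i` makes `e` parallel to the
    -- spoke from the other hub `d`.
    refine Matroid.klPoly_deleteElem_of_parallel (f := s(Sum.inl d, Sum.inr i))
      hG.loopless_contract (by simp) ?_
    rw [Matroid.contract_closure_eq]
    refine ⟨Matroid.closure_subset_closure _ ?_ (mem_closure_thagomizerGraph_of_ne i hcd), heG⟩
    exact Set.insert_subset (Or.inr hxG) (Set.singleton_subset_iff.2 (Or.inl rfl))

end SimpleGraph

theorem mainTheorem5 (n : ℕ) (hn : 2 ≤ n) :
    (SimpleGraph.thagomizerGraph n).cycleMatroid.klPoly =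
      (completeBipartiteGraph (Fin 2) (Fin n)).cycleMatroid.klPoly - Polynomial.X := by
  exact SimpleGraph.klPoly_thagomizerGraph hn
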